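/- Let $k\ge 2$ be an integer. There are a deterministic algorithm and a constant $\gamma_0>0$, both depending only on $k$, such that for every $0<\gamma<\gamma_0$ there is an $n_0$ for which the following holds for all $n\ge n_0$. Let $H$ be a $k$-uniform hypergraph whose vertex set is partitioned into $V_1,\dots,V_k$ with $|V_i|=n$ for each $i$, such that every edge of $H$ meets all of $V_1,\dots,V_k$. Suppose that every vertex of $V_1$ lies in at least $(1-\gamma)n^{k-1}$ edges of $H$, and that every set consisting of one vertex from each of $V_2,\dots,V_k$ is contained in at least $(1-\gamma)n$ edges of $H$. Then the algorithm, given $H$, finds a perfect matching in $H$ (a set of pairwise disjoint edges covering all vertices) in time $O(n^{4(k-1)})$, where the implied constant depends only on $k$. Here $H$ is given by $n$ and its adjacency tensor (a $0/1$ array with one entry for each $(v_1,\dots,v_k)\in V_1\times\cdots\times V_k$, each $V_i$ being labelled by $\{0,\dots,n-1\}$), and time is the number of steps of a program on a word RAM whose words have $O(\log n)$ bits, the implied constant again depending only on $k$. -/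

import Mathlib

/-! ## Hypergraphs -/

namespace HyperMatching

/-- A `k`-uniform hypergraph (`k`-graph) on the vertex set `V`. -/
structure KGraph (V : Type*) (k : ℕ) where
  edges : Finset (Finset V)
  uniform : ∀ e ∈ edges, e.card = k

/-- The degree of a set of vertices: the number of edges that contain it. -/
def KGraph.degree {V : Type*} [DecidableEq V] {k : ℕ} (H : KGraph V k) (S : Finset V) : ℕ :=
  (H.edges.filter fun e => S ⊆ e).card

/-- A perfect matching: a set of pairwise disjoint edges that covers every vertex. -/
def KGraph.IsPerfectMatching {V : Type*} {k : ℕ} (H : KGraph V k)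
    (M : Finset (Finset V)) : Prop :=
  M ⊆ H.edges ∧ (∀ e ∈ M, ∀ f ∈ M, e ≠ f → Disjoint e f) ∧ ∀ x : V, ∃ e ∈ M, x ∈ e

/-- The vertices of the `k` parts are labelled so that the `i`-th part is `{i} × Fin n`.
The `k`-graph is `k`-partite with respect to these parts if every edge meets every part. -/
def KGraph.IsPartite {k n : ℕ} (H : KGraph (Fin k × Fin n) k) : Prop :=
  ∀ e ∈ H.edges, ∀ i : Fin k, ∃ x ∈ e, x.1 = i

/-- The set which consists of the vertex `v i` of the `i`-th part for each `i ∈ S`. -/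
def transversal {k n : ℕ} (S : Finset (Fin k)) (v : Fin k → Fin n) : Finset (Fin k × Fin n) :=
  S.image fun i => (i, v i)

/-- `δ_S(H)`: the minimum degree of a set which consists of one vertex in each of the parts
indexed by `S` (a minimum over a nonempty finite family if `n ≥ 1`). -/
noncomputable def KGraph.minDegree {k n : ℕ} (H : KGraph (Fin k × Fin n) k)
    (S : Finset (Fin k)) : ℕ :=
  ⨅ v : Fin k → Fin n, H.degree (transversal S v)

/-! ## The machine model: a deterministic word RAM

A program uses variables (registers) and arrays, each with a fixed number as its name; all hold
natural numbers. The model has a word bound `W`: if an operation has a result that is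
not below `W`, the program is stuck, so every number that a run computes is a machine word. -/

/-- The memory: the values of the registers, and the contents of the arrays. -/
structure Store where
  var : ℕ → ℕ
  arr : ℕ → ℕ → ℕ

/-- The operations on words. -/
inductive BinOp where
  | add | sub | mul | div | mod | lt | eq

/-- Subtraction is truncated, division is rounded down, and a comparison yields `0` or `1`. -/
def BinOp.apply : BinOp → ℕ → ℕ → ℕ
  | .add, a, b => a + b
  | .sub, a, b => a - b
  | .mul, a, b => a * b
  | .div, a, b => a / b
  | .mod, a, b => a % b
  | .lt, a, b => if a < b then 1 else 0
  | .eq, a, b => if a = b then 1 else 0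

/-- Expressions: constants, registers, array lookup, and word operations. -/
inductive Term where
  | lit (c : ℕ)
  | var (x : ℕ)
  | get (a : ℕ) (i : Term)
  | bin (o : BinOp) (p q : Term)

/-- The value of an expression; `none` if the word bound is exceeded on the way. -/
def Term.eval (W : ℕ) (s : Store) : Term → Option ℕ
  | .lit c => if c < W then some c else none
  | .var x => some (s.var x)
  | .get a i => (i.eval W s).map (s.arr a)
  | .bin o p q =>
    (p.eval W s).bind fun a => (q.eval W s).bind fun b =>
      if o.apply a b < W then some (o.apply a b) else none

/-- The time to evaluate an expression: one step for each constant, register access,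
array lookup and operation in it. -/
def Term.cost : Term → ℕ
  | .lit _ => 1
  | .var _ => 1
  | .get _ i => i.cost + 1
  | .bin _ p q => p.cost + q.cost + 1

/-- Programs. -/
inductive Program where
  | skip
  | assign (x : ℕ) (e : Term)
  | store (a : ℕ) (i e : Term)
  | seq (p q : Program)
  | ite (e : Term) (p q : Program)
  | loop (e : Term) (p : Program)

/-- The store after `x := v`. -/
def Store.setVar (s : Store) (x v : ℕ) : Store :=
  { s with var := Function.update s.var x v }

/-- The store after `a[i] := v`. -/
def Store.setArr (s : Store) (a i v : ℕ) : Store :=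
  { s with arr := Function.update s.arr a (Function.update (s.arr a) i v) }

/-- `Run W p s t s'`: with word bound `W`, the program `p` started in the store `s` halts after
exactly `t` steps in the store `s'`. A test succeeds if its value is not `0`; `loop e p` is
"while `e` do `p`". -/
inductive Run (W : ℕ) : Program → Store → ℕ → Store → Prop
  | skip (s : Store) : Run W .skip s 1 s
  | assign (s : Store) (x : ℕ) (e : Term) (v : ℕ) (he : e.eval W s = some v) :
      Run W (.assign x e) s (e.cost + 1) (s.setVar x v)
  | store (s : Store) (a : ℕ) (i e : Term) (j v : ℕ) (hi : i.eval W s = some j)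
      (he : e.eval W s = some v) :
      Run W (.store a i e) s (i.cost + e.cost + 1) (s.setArr a j v)
  | seq (p q : Program) (s s' s'' : Store) (t t' : ℕ) (hp : Run W p s t s')
      (hq : Run W q s' t' s'') : Run W (.seq p q) s (t + t') s''
  | ite_true (e : Term) (p q : Program) (s s' : Store) (t v : ℕ) (he : e.eval W s = some v)
      (hv : v ≠ 0) (hp : Run W p s t s') : Run W (.ite e p q) s (e.cost + 1 + t) s'
  | ite_false (e : Term) (p q : Program) (s s' : Store) (t : ℕ) (he : e.eval W s = some 0)
      (hq : Run W q s t s') : Run W (.ite e p q) s (e.cost + 1 + t) s'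
  | loop_stop (e : Term) (p : Program) (s : Store) (he : e.eval W s = some 0) :
      Run W (.loop e p) s (e.cost + 1) s
  | loop_step (e : Term) (p : Program) (s s' s'' : Store) (t t' v : ℕ)
      (he : e.eval W s = some v) (hv : v ≠ 0) (hp : Run W p s t s')
      (hl : Run W (.loop e p) s' t' s'') : Run W (.loop e p) s (e.cost + 1 + t + t') s''

/-- The machine is deterministic: the store determines the running time and the final store. -/
theorem Run.deterministic {W : ℕ} {p : Program} {s s₁ s₂ : Store} {t₁ t₂ : ℕ}
    (h₁ : Run W p s t₁ s₁) (h₂ : Run W p s t₂ s₂) : t₁ = t₂ ∧ s₁ = s₂ := by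
  induction h₁ generalizing t₂ s₂ with
  | skip => cases h₂; simp
  | assign _ _ _ _ he => cases h₂; simp_all
  | store _ _ _ _ _ _ hi he => cases h₂; simp_all
  | seq _ _ _ _ _ _ _ _ _ ihp ihq =>
    cases h₂ with
    | seq _ _ _ _ _ _ _ hp hq =>
      obtain ⟨rfl, rfl⟩ := ihp hp
      obtain ⟨rfl, rfl⟩ := ihq hq
      simp
  | ite_true _ _ _ _ _ _ _ he hv _ ih =>
    cases h₂ with
    | ite_true _ _ _ _ _ _ _ _ _ hp => obtain ⟨rfl, rfl⟩ := ih hp; simp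
    | ite_false _ _ _ _ _ _ he' _ => simp_all
  | ite_false _ _ _ _ _ _ he _ ih =>
    cases h₂ with
    | ite_true _ _ _ _ _ _ _ he' _ _ => simp_all
    | ite_false _ _ _ _ _ _ _ hq => obtain ⟨rfl, rfl⟩ := ih hq; simp
  | loop_stop _ _ _ he =>
    cases h₂ with
    | loop_stop => simp
    | loop_step _ _ _ _ _ _ _ _ he' => simp_all
  | loop_step _ _ _ _ _ _ _ _ he hv _ _ ihp ihl =>
    cases h₂ with
    | loop_stop _ _ _ he' => simp_all
    | loop_step _ _ _ _ _ _ _ _ _ _ hp hl =>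
      obtain ⟨rfl, rfl⟩ := ihp hp
      obtain ⟨rfl, rfl⟩ := ihl hl
      simp

/-! ## Input and output -/

open Classical in
/-- The initial store for a `k`-graph with parts `{i} × Fin n`: register `0` holds `n`, array `0`
holds the adjacency tensor (the entry with index `∑ i, v i * n ^ i` is `1` if the vertices
`(i, v i)` form an edge, and `0` otherwise), and all the rest is `0`. -/
noncomputable def inputStore {k n : ℕ} (H : KGraph (Fin k × Fin n) k) : Store where
  var x := if x = 0 then n else 0
  arr a j :=
    if a = 0 ∧ ∃ v : Fin k → Fin n,
      j = ∑ i, (v i : ℕ) * n ^ (i : ℕ) ∧ transversal Finset.univ v ∈ H.edges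
    then 1 else 0

/-- The store contains a perfect matching of `H` as a list of `n` edges: the vertex of the `j`-th
edge in the `i`-th part is `(i, m)`, where `m` is the entry `j * k + i` of array `1`. -/
def OutputsPerfectMatching {k n : ℕ} (H : KGraph (Fin k × Fin n) k) (s : Store) : Prop :=
  ∃ m : Fin n → Fin k → Fin n,
    (∀ (j : Fin n) (i : Fin k), s.arr 1 ((j : ℕ) * k + (i : ℕ)) = (m j i : ℕ)) ∧
    H.IsPerfectMatching (Finset.univ.image fun j => transversal Finset.univ (m j))

end HyperMatching

/-! Write k = K + 1. The algorithm keeps n rows, each with one vertex in every part, such that every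
column is a permutation; once all rows are edges they form a perfect matching. Round a makes row a
an edge without spoiling rows that already are. It chooses rows J 0 = a, J 1, ..., J K and permutes
their entries within each column (`exchange`), so columns remain permutations, and it requires all K
+ 1 new rows to be edges.

Such a J exists by counting (`KGraph.IsPartite.exists_canExchange`). There are n^K tuples with J 0 =
a. The new row 0 takes its i-th entry from row J i: it contains the fixed vertex of row a in the
first part, and the degree of that vertex leaves at most γ n^K bad tuples. In any other new row, the
first-part vertex comes from a chosen row that supplies nothing else to it (`exchange_ne`), so with
the other coordinates fixed, the codegree condition leaves at most γ n bad values, again γ n^K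
tuples in all. Tuples with a repeated row number at most (K + 1)^2 n^(K-1). For γ ≤ 1/(2k) and n >
2k^2 this does not exhaust n^K.

Exhaustive search through n^(K+1) codes in each of n rounds takes O(n^(k+1)) steps, within
n^(4(k-1)) as k ≥ 2. The rest verifies this on the word RAM with loop invariants. -/

namespace HyperMatching

open Finset Function

/-! ## Edges of a partite hypergraph as vertex tuples -/

/-- The vertices `(i, w i)` form an edge. -/
def KGraph.IsEdge {k n : ℕ} (H : KGraph (Fin k × Fin n) k) (w : Fin k → Fin n) : Prop :=
  transversal univ w ∈ H.edges

theorem mem_transversal {k n : ℕ} {S : Finset (Fin k)} {v : Fin k → Fin n} {x : Fin k × Fin n} :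
    x ∈ transversal S v ↔ x.1 ∈ S ∧ v x.1 = x.2 := by
  constructor
  · intro h
    obtain ⟨i, hi, rfl⟩ := mem_image.1 h
    exact ⟨hi, rfl⟩
  · rintro ⟨h, h'⟩
    exact mem_image.2 ⟨x.1, h, Prod.ext rfl h'⟩

/-- An edge has k vertices and meets all k parts, so one vertex chosen from each part already
exhausts it. -/
theorem KGraph.IsPartite.exists_eq_transversal {k n : ℕ} {H : KGraph (Fin k × Fin n) k}
    (hH : H.IsPartite) {e : Finset (Fin k × Fin n)} (he : e ∈ H.edges) :
    ∃ w, transversal univ w = e := by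
  choose x hx hx' using hH e he
  refine ⟨fun i => (x i).2, eq_of_subset_of_card_le ?_ ?_⟩
  · intro y hy
    obtain ⟨-, hy⟩ := mem_transversal.1 hy
    have : y = x y.1 := Prod.ext (hx' _).symm hy.symm
    rw [this]
    exact hx _
  · rw [H.uniform e he, transversal, card_image_of_injective _ fun i j h => congrArg Prod.fst h]
    simp

open Classical in
theorem KGraph.IsPartite.degree_le {k n : ℕ} {H : KGraph (Fin k × Fin n) k}
    (hH : H.IsPartite) (S : Finset (Fin k)) (v : Fin k → Fin n) :
    H.degree (transversal S v) ≤ #{w | H.IsEdge w ∧ ∀ i ∈ S, w i = v i} := by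
  refine (card_le_card fun e he => ?_).trans (card_image_le (f := transversal univ))
  obtain ⟨he, hS⟩ := mem_filter.1 he
  obtain ⟨w, rfl⟩ := hH.exists_eq_transversal he
  refine mem_image.2 ⟨w, mem_filter.2 ⟨mem_univ _, he, fun i hi => ?_⟩, rfl⟩
  exact (mem_transversal.1 (hS (mem_transversal.2 ⟨hi, rfl⟩ : (i, v i) ∈ _))).2

theorem KGraph.minDegree_le {k n : ℕ} (H : KGraph (Fin k × Fin n) k) (S : Finset (Fin k))
    (v : Fin k → Fin n) : H.minDegree S ≤ H.degree (transversal S v) :=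
  ciInf_le (OrderBot.bddBelow _) v

theorem card_filter_apply_zero_eq {K n : ℕ} (a : Fin n) :
    #{w : Fin (K + 1) → Fin n | w 0 = a} = n ^ K := by
  have : ({w : Fin (K + 1) → Fin n | w 0 = a} : Finset _) =
      Fintype.piFinset fun i => if i = 0 then {a} else univ := by
    ext w
    simp only [mem_filter, mem_univ, true_and, Fintype.mem_piFinset]
    constructor
    · intro h i
      split_ifs with hi <;> simp [hi, h]
    · intro h
      simpa using h 0
  rw [this, Fintype.card_piFinset, Fin.prod_univ_succ]
  simp

open Classical in
theorem KGraph.IsPartite.card_not_isEdge_le {K n : ℕ} {H : KGraph (Fin (K + 1) × Fin n) (K + 1)}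
    (hH : H.IsPartite) {γ : ℝ} (h : (1 - γ) * (n : ℝ) ^ K ≤ H.minDegree {0}) (a : Fin n) :
    (#{w : Fin (K + 1) → Fin n | w 0 = a ∧ ¬H.IsEdge w} : ℝ) ≤ γ * n ^ K := by
  have h1 := (H.minDegree_le {0} fun _ => a).trans (hH.degree_le {0} fun _ => a)
  have h2 := card_filter_add_card_filter_not (s := {w : Fin (K + 1) → Fin n | w 0 = a}) H.IsEdge
  rw [card_filter_apply_zero_eq, filter_filter, filter_filter] at h2
  simp only [mem_singleton, forall_eq, and_comm (a := H.IsEdge _)] at h1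
  have h1' : (H.minDegree {0} : ℝ) ≤ _ := Nat.cast_le.2 h1
  have h2' := congrArg (Nat.cast (R := ℝ)) h2
  push_cast at h2'
  linarith

open Classical in
theorem KGraph.IsPartite.card_not_isEdge_update_le {K n : ℕ}
    {H : KGraph (Fin (K + 1) × Fin n) (K + 1)} (hH : H.IsPartite) {γ : ℝ}
    (h : (1 - γ) * (n : ℝ) ≤ H.minDegree (univ \ {0})) (w : Fin (K + 1) → Fin n) :
    (#{y | ¬H.IsEdge (update w 0 y)} : ℝ) ≤ γ * n := by
  have h1 := (H.minDegree_le _ w).trans (hH.degree_le (univ \ {0}) w)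
  have h2 := card_filter_add_card_filter_not (s := (univ : Finset (Fin n)))
    fun y => H.IsEdge (update w 0 y)
  have h3 : #{w' | H.IsEdge w' ∧ ∀ i ∈ univ \ {(0 : Fin (K + 1))}, w' i = w i} ≤
      #{y | H.IsEdge (update w 0 y)} := by
    -- A tuple that agrees with `w` off coordinate 0 is determined by its value there, so edges
    -- inject into values `y`.
    have key : ∀ w' : Fin (K + 1) → Fin n, (∀ i ∈ univ \ {(0 : Fin (K + 1))}, w' i = w i) →
        update w 0 (w' 0) = w' := by
      intro w' hw'
      ext i
      by_cases hi : i = 0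
      · subst hi; simp
      · rw [update_of_ne hi, hw' i (by simp [hi])]
    refine card_le_card_of_injOn (fun w' => w' 0) (fun w' hw' => ?_) fun w₁ h₁ w₂ h₂ h₁₂ => ?_
    · simp only [coe_filter, mem_univ, true_and, Set.mem_ofPred_eq] at hw' ⊢
      rw [key w' hw'.2]
      exact hw'.1
    · simp only [coe_filter, mem_univ, true_and, Set.mem_ofPred_eq] at h₁ h₂ h₁₂
      rw [← key w₁ h₁.2, ← key w₂ h₂.2, h₁₂]
  have h1' : (H.minDegree (univ \ {0}) : ℝ) ≤ _ := Nat.cast_le.2 (h1.trans h3)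
  have h2' := congrArg (Nat.cast (R := ℝ)) h2
  push_cast [card_univ, Fintype.card_fin] at h2'
  linarith

/-! ## The exchange step -/

/-- If a property holds for few values of one free coordinate, then it holds for few tuples. -/
theorem card_mul_le_of_card_update_le {K n : ℕ} {a : Fin n} {q : Fin (K + 1)} (hq : q ≠ 0)
    (P : (Fin (K + 1) → Fin n) → Prop) [DecidablePred P] {B : ℝ}
    (h : ∀ J, (#{y | P (update J q y)} : ℝ) ≤ B) :
    (n : ℝ) * #{J : Fin (K + 1) → Fin n | J 0 = a ∧ P J} ≤ n ^ K * B := by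
  have h1 : ∑ J ∈ ({J | J 0 = a} : Finset (Fin (K + 1) → Fin n)), ∑ y : Fin n,
      (if P (update J q y) then (1 : ℝ) else 0) =
      ∑ J ∈ ({J | J 0 = a} : Finset (Fin (K + 1) → Fin n)), ∑ _y : Fin n,
      if P J then (1 : ℝ) else 0 := by
    rw [← sum_product', ← sum_product']
    -- Trading the free value with the q-th coordinate is an involution on the pairs (J, y); it
    -- preserves `J 0 = a` because `q ≠ 0`.
    refine sum_nbij' (fun x => (update x.1 q x.2, x.1 q)) (fun x => (update x.1 q x.2, x.1 q))
      ?_ ?_ ?_ ?_ ?_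
    · simp +contextual [update_of_ne hq.symm]
    · simp +contextual [update_of_ne hq.symm]
    · simp
    · simp
    · simp
  have h2 : ∑ J ∈ ({J | J 0 = a} : Finset (Fin (K + 1) → Fin n)), ∑ y : Fin n,
      (if P (update J q y) then (1 : ℝ) else 0) ≤
      ∑ _J ∈ ({J | J 0 = a} : Finset (Fin (K + 1) → Fin n)), B :=
    sum_le_sum fun J _ => by simpa using h J
  rw [h1, sum_const, card_filter_apply_zero_eq] at h2
  simpa only [sum_const, card_univ, Fintype.card_fin, nsmul_eq_mul, ← mul_sum, sum_boole,
    filter_filter, Nat.cast_pow] using h2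

/-- The permutation of the chosen rows in the `i`-th column in an exchange: the rows `0` and `i`
are swapped if `i ≠ 0`, and the rows other than `0` are rotated if `i = 0`. -/
def exchange {K : ℕ} (i : Fin (K + 1)) : Equiv.Perm (Fin (K + 1)) :=
  if i = 0 then Equiv.Perm.decomposeFin.symm (0, finRotate K) else Equiv.swap 0 i

theorem exchange_apply_zero {K : ℕ} (i : Fin (K + 1)) : exchange i 0 = i := by
  unfold exchange
  split_ifs with h
  · simp [h]
  · simp

theorem exchange_zero_succ {K : ℕ} (l : Fin K) : exchange 0 l.succ = (finRotate K l).succ := by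
  simp [exchange]

/-- The source of the first-part vertex in new row `l` supplies no other entry of that row. In
column `i ≠ 0` the source is `l`, or 0 if `i = l`, while column 0 uses the rotation of `l`, which is
nonzero and differs from `l` when K ≥ 2. If K = 1, only `i = l` occurs. -/
theorem exchange_ne {K : ℕ} {i l : Fin (K + 1)} (hi : i ≠ 0) (hl : l ≠ 0) :
    exchange i l ≠ exchange 0 l := by
  obtain ⟨l, rfl⟩ := Fin.exists_succ_eq.2 hl
  obtain ⟨i, rfl⟩ := Fin.exists_succ_eq.2 hi
  rw [exchange_zero_succ, exchange, if_neg hi]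
  rcases eq_or_ne l i with rfl | h
  · rw [Equiv.swap_apply_right]
    exact (Fin.succ_ne_zero _).symm
  · rw [Equiv.swap_apply_of_ne_of_ne hl fun h' => h (Fin.succ_injective _ h')]
    intro h'
    have h'' := Fin.succ_injective _ h'
    obtain _ | K := K
    · exact l.elim0
    rw [finRotate_apply] at h''
    obtain _ | K := K
    · exact h (Fin.ext (by omega))
    · simp at h''

/-- This source is not the prescribed row `J 0 = a`, so its coordinate is free to vary. -/
theorem exchange_zero_ne_zero {K : ℕ} {l : Fin (K + 1)} (hl : l ≠ 0) : exchange 0 l ≠ 0 := by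
  obtain ⟨l, rfl⟩ := Fin.exists_succ_eq.2 hl
  rw [exchange_zero_succ]
  exact Fin.succ_ne_zero _

/-- The rows `J l` of `m` can be exchanged: they are distinct, and the new rows are edges. -/
def KGraph.CanExchange {K n : ℕ} (H : KGraph (Fin (K + 1) × Fin n) (K + 1))
    (m : Fin n → Fin (K + 1) → Fin n) (J : Fin (K + 1) → Fin n) : Prop :=
  Injective J ∧ ∀ l, H.IsEdge fun i => m (J (exchange i l)) i

open Classical in
theorem KGraph.IsPartite.exists_canExchange {K n : ℕ} {H : KGraph (Fin (K + 1) × Fin n) (K + 1)}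
    (hH : H.IsPartite) {γ : ℝ} (hγ : 2 * (K + 1) * γ ≤ 1) (hn : 2 * (K + 1) ^ 2 < n)
    (h₁ : (1 - γ) * (n : ℝ) ^ K ≤ H.minDegree {0})
    (h₂ : (1 - γ) * (n : ℝ) ≤ H.minDegree (univ \ {0}))
    {m : Fin n → Fin (K + 1) → Fin n} (hm : ∀ i, Injective fun j => m j i) (a : Fin n) :
    ∃ J : Fin (K + 1) → Fin n, J 0 = a ∧ H.CanExchange m J := by
  have hn0 : (0 : ℝ) < n := Nat.cast_pos.2 (by omega)
  -- `A l` collects the tuples whose new row `l` is not an edge, and `D` those with a coincidence `J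
  -- p = J q`. Taking `q ≠ 0` in `D` leaves `q` as the free coordinate.
  let A : Fin (K + 1) → Finset (Fin (K + 1) → Fin n) := fun l =>
    {J | J 0 = a ∧ ¬H.IsEdge fun i => m (J (exchange i l)) i}
  let D : Fin (K + 1) × Fin (K + 1) → Finset (Fin (K + 1) → Fin n) := fun x =>
    if x.2 ≠ 0 ∧ x.1 ≠ x.2 then ({J | J 0 = a ∧ J x.1 = J x.2} : Finset _) else ∅
  have hA : ∀ l, (n : ℝ) * #(A l) ≤ n ^ K * (γ * n) := by
    intro l
    rcases eq_or_ne l 0 with rfl | hl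
    · have : (#(A 0) : ℝ) ≤ γ * n ^ K := by
        refine le_trans (Nat.cast_le.2 ?_) (hH.card_not_isEdge_le h₁ (m a 0))
        refine card_le_card_of_injOn (fun J i => m (J i) i) (fun J hJ => ?_)
          fun J _ J' _ hJJ' => ?_
        · simp only [A, coe_filter, mem_univ, true_and, Set.mem_ofPred_eq,
            exchange_apply_zero] at hJ ⊢
          exact ⟨by rw [hJ.1], hJ.2⟩
        · funext i
          exact hm i (congrFun hJJ' i)
      nlinarith
    · refine card_mul_le_of_card_update_le (exchange_zero_ne_zero hl) _ fun J => ?_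
      refine le_trans (Nat.cast_le.2 ?_)
        (hH.card_not_isEdge_update_le h₂ fun i => m (J (exchange i l)) i)
      refine card_le_card_of_injOn (fun y => m y 0) (fun y hy => ?_) (hm 0).injOn
      simp only [coe_filter, mem_univ, true_and, Set.mem_ofPred_eq] at hy ⊢
      convert hy using 2
      funext i
      rcases eq_or_ne i 0 with rfl | hi
      · simp
      · rw [update_of_ne hi, update_of_ne (exchange_ne hi hl)]
  have hD : ∀ x, (n : ℝ) * #(D x) ≤ n ^ K * 1 := by
    rintro ⟨p, q⟩
    by_cases hpq : q ≠ 0 ∧ p ≠ q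
    · simp only [D, if_pos hpq]
      refine card_mul_le_of_card_update_le hpq.1 _ fun J => ?_
      have : #{y | update J q y p = update J q y q} ≤ 1 := by
        refine card_le_one.2 fun y hy z hz => ?_
        simp only [mem_filter, mem_univ, true_and, update_self, update_of_ne hpq.2] at hy hz
        rw [← hy, hz]
      exact_mod_cast this
    · simp only [D, if_neg hpq]
      simp
  by_contra! hcon
  have hcover : ({J | J 0 = a} : Finset (Fin (K + 1) → Fin n)) ⊆
      univ.biUnion A ∪ univ.biUnion D := by
    intro J hJ
    have hJ0 := (mem_filter.1 hJ).2
    have hJ1 := hcon J hJ0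
    simp only [mem_union, mem_biUnion, mem_univ, true_and]
    by_cases hinj : Injective J
    · left
      simp only [KGraph.CanExchange, hinj, true_and, not_forall] at hJ1
      obtain ⟨l, hl⟩ := hJ1
      exact ⟨l, by simp only [A, mem_filter, mem_univ, true_and]; exact ⟨hJ0, hl⟩⟩
    · right
      simp only [Injective, not_forall] at hinj
      obtain ⟨p, q, hpq, hne⟩ := hinj
      rcases eq_or_ne q 0 with rfl | hq
      · exact ⟨(0, p), by simp [D, hne, Ne.symm hne, hJ0, hpq]⟩
      · exact ⟨(p, q), by simp [D, hq, hne, hJ0, hpq]⟩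
  have hcard := (card_le_card hcover).trans
    ((card_union_le _ _).trans (Nat.add_le_add card_biUnion_le card_biUnion_le))
  rw [card_filter_apply_zero_eq] at hcard
  have hcard' : (n : ℝ) ^ K ≤ ∑ l, (#(A l) : ℝ) + ∑ x, (#(D x) : ℝ) := by exact_mod_cast hcard
  have hsA : ∑ l, (n : ℝ) * #(A l) ≤ ∑ _l : Fin (K + 1), n ^ K * (γ * n) :=
    sum_le_sum fun l _ => hA l
  have hsD : ∑ x, (n : ℝ) * #(D x) ≤ ∑ _x : Fin (K + 1) × Fin (K + 1), (n : ℝ) ^ K * 1 :=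
    sum_le_sum fun x _ => hD x
  rw [← mul_sum] at hsA hsD
  simp only [sum_const, card_univ, Fintype.card_prod, Fintype.card_fin, nsmul_eq_mul,
    Nat.cast_mul, Nat.cast_add, Nat.cast_one] at hsA hsD
  have hpow : (0 : ℝ) < (n : ℝ) ^ K := by positivity
  have hn' : (2 : ℝ) * (K + 1) ^ 2 < n := by exact_mod_cast hn
  -- All bounds carry an extra factor n, which avoids the exponent K - 1. Each of the two terms in
  -- the bracket accounts for at most n / 2, the second strictly less.
  have htot : (n : ℝ) ^ K * n ≤ n ^ K * ((K + 1) * γ * n + (K + 1) ^ 2) := by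
    nlinarith [mul_le_mul_of_nonneg_left hcard' hn0.le]
  have := le_of_mul_le_mul_left htot hpow
  nlinarith [mul_le_mul_of_nonneg_right hγ hn0.le]

/-- The rows of `m` after the exchange of the rows `J l`. -/
noncomputable def exchangeRows {K n : ℕ} (m : Fin n → Fin (K + 1) → Fin n)
    (J : Fin (K + 1) ↪ Fin n) (p : Fin n) (i : Fin (K + 1)) : Fin n :=
  m ((exchange i).viaEmbedding J p) i

theorem exchangeRows_injective {K n : ℕ} {m : Fin n → Fin (K + 1) → Fin n}
    (hm : ∀ i, Injective fun j => m j i) (J : Fin (K + 1) ↪ Fin n) (i : Fin (K + 1)) :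
    Injective fun j => exchangeRows m J j i :=
  (hm i).comp (Equiv.injective _)

theorem exchangeRows_apply {K n : ℕ} (m : Fin n → Fin (K + 1) → Fin n)
    (J : Fin (K + 1) ↪ Fin n) (l i : Fin (K + 1)) :
    exchangeRows m J (J l) i = m (J (exchange i l)) i := by
  rw [exchangeRows, Equiv.Perm.viaEmbedding_apply]

theorem exchangeRows_apply_of_notMem {K n : ℕ} (m : Fin n → Fin (K + 1) → Fin n)
    {J : Fin (K + 1) ↪ Fin n} {p : Fin n} (hp : p ∉ Set.range J) :
    exchangeRows m J p = m p := by
  funext i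
  rw [exchangeRows, Equiv.Perm.viaEmbedding_apply_of_notMem _ _ _ hp]

/-- Injective columns make the rows disjoint; by finiteness they are also surjective, so every
vertex is covered. -/
theorem KGraph.isPerfectMatching_image_transversal {k n : ℕ} {H : KGraph (Fin k × Fin n) k}
    {m : Fin n → Fin k → Fin n} (hm : ∀ i, Injective fun j => m j i)
    (hE : ∀ j, H.IsEdge (m j)) :
    H.IsPerfectMatching (univ.image fun j => transversal univ (m j)) := by
  refine ⟨?_, ?_, ?_⟩
  · intro e he
    obtain ⟨j, -, rfl⟩ := mem_image.1 he
    exact hE j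
  · intro e he f hf hef
    obtain ⟨j, -, rfl⟩ := mem_image.1 he
    obtain ⟨j', -, rfl⟩ := mem_image.1 hf
    refine disjoint_left.2 fun x hx hx' => hef ?_
    have : j = j' := hm x.1 ((mem_transversal.1 hx).2.trans (mem_transversal.1 hx').2.symm)
    rw [this]
  · rintro ⟨i, y⟩
    obtain ⟨j, hj⟩ := (Finite.injective_iff_surjective.1 (hm i)) y
    exact ⟨_, mem_image_of_mem _ (mem_univ j), mem_transversal.2 ⟨mem_univ _, hj⟩⟩

/-! ## Evaluation of expressions -/

theorem Term.eval_lit {W : ℕ} {s : Store} {c : ℕ} (h : c < W) : (lit c).eval W s = some c :=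
  if_pos h

theorem Term.eval_var {W : ℕ} {s : Store} {x v : ℕ} (h : s.var x = v) :
    (var x).eval W s = some v :=
  congrArg some h

theorem Term.eval_get {W : ℕ} {s : Store} {a j v : ℕ} {i : Term} (hi : i.eval W s = some j)
    (h : s.arr a j = v) : (get a i).eval W s = some v := by
  simp [eval, hi, h]

theorem Term.eval_bin {W : ℕ} {s : Store} {o : BinOp} {p q : Term} {a b : ℕ}
    (hp : p.eval W s = some a) (hq : q.eval W s = some b) (h : o.apply a b < W) :
    (bin o p q).eval W s = some (o.apply a b) := by
  simp [eval, hp, hq, h]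

/-- The power of an expression with a fixed exponent. -/
def Term.pow (e : Term) : ℕ → Term
  | 0 => .lit 1
  | N + 1 => .bin .mul (e.pow N) e

/-- Positivity of the base keeps intermediate powers below the final one, hence below the word
bound. -/
theorem Term.eval_pow {W : ℕ} {s : Store} {e : Term} {v : ℕ} (he : e.eval W s = some v)
    (hv : 0 < v) (N : ℕ) (hW : v ^ N < W) : (e.pow N).eval W s = some (v ^ N) := by
  induction N with
  | zero => exact eval_lit hW
  | succ N ih =>
    have h : v ^ N ≤ v ^ (N + 1) := Nat.pow_le_pow_right hv N.le_succ
    exact eval_bin (o := .mul) (ih (h.trans_lt hW)) he hW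

/-- The sum of a fixed number of expressions. -/
def Term.sum : (N : ℕ) → (Fin N → Term) → Term
  | 0, _ => .lit 0
  | N + 1, f => .bin .add (Term.sum N fun i => f i.castSucc) (f (Fin.last N))

theorem Term.eval_sum {W : ℕ} {s : Store} {N : ℕ} {f : Fin N → Term} {g : Fin N → ℕ}
    (h : ∀ i, (f i).eval W s = some (g i)) (hW : ∑ i, g i < W) :
    (Term.sum N f).eval W s = some (∑ i, g i) := by
  induction N with
  | zero => simpa [Term.sum] using eval_lit hW
  | succ N ih =>
    rw [Fin.sum_univ_castSucc] at hW ⊢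
    exact eval_bin (o := .add) (ih (fun i => h i.castSucc) (by omega)) (h _) hW

/-- The product of a fixed number of expressions. -/
def Term.prod : (N : ℕ) → (Fin N → Term) → Term
  | 0, _ => .lit 1
  | N + 1, f => .bin .mul (Term.prod N fun i => f i.castSucc) (f (Fin.last N))

/-- The value of the expression is `1` or `0`, according to whether `P` holds. -/
def Term.Decides (W : ℕ) (s : Store) (e : Term) (P : Prop) : Prop :=
  ∃ v, e.eval W s = some v ∧ v ≤ 1 ∧ (v ≠ 0 ↔ P)

/-- For values in {0, 1} the product is conjunction and cannot overflow. -/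
theorem Term.Decides.mul {W : ℕ} {s : Store} {p q : Term} {P Q : Prop} (hp : p.Decides W s P)
    (hq : q.Decides W s Q) (hW : 1 < W) : (bin .mul p q).Decides W s (P ∧ Q) := by
  obtain ⟨v, hv, hv1, hvP⟩ := hp
  obtain ⟨w, hw, hw1, hwQ⟩ := hq
  have h : v * w ≤ 1 := Nat.mul_le_mul hv1 hw1
  exact ⟨v * w, eval_bin (o := .mul) hv hw (h.trans_lt hW), h, by rw [← hvP, ← hwQ, mul_ne_zero_iff]⟩

theorem Term.Decides.prod {W : ℕ} {s : Store} {N : ℕ} {f : Fin N → Term} {P : Fin N → Prop}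
    (h : ∀ i, (f i).Decides W s (P i)) (hW : 1 < W) :
    (Term.prod N f).Decides W s (∀ i, P i) := by
  induction N with
  | zero => exact ⟨1, eval_lit hW, le_rfl, by simp⟩
  | succ N ih =>
    rw [Fin.forall_fin_succ']
    exact (ih fun i => h i.castSucc).mul (h _) hW

theorem Term.decides_eq {W : ℕ} {s : Store} {p q : Term} {a b : ℕ} (hp : p.eval W s = some a)
    (hq : q.eval W s = some b) (hW : 1 < W) : (bin .eq p q).Decides W s (a = b) := by
  have h : BinOp.eq.apply a b ≤ 1 := by
    unfold BinOp.apply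
    dsimp only
    split_ifs <;> simp
  exact ⟨_, eval_bin hp hq (h.trans_lt hW), h, by simp [BinOp.apply]⟩

theorem Term.decides_lt {W : ℕ} {s : Store} {p q : Term} {a b : ℕ} (hp : p.eval W s = some a)
    (hq : q.eval W s = some b) (hW : 1 < W) : (bin .lt p q).Decides W s (a < b) := by
  have h : BinOp.lt.apply a b ≤ 1 := by
    unfold BinOp.apply
    dsimp only
    split_ifs <;> simp
  exact ⟨_, eval_bin hp hq (h.trans_lt hW), h, by simp [BinOp.apply]⟩

theorem Term.Decides.not {W : ℕ} {s : Store} {p : Term} {P : Prop} (hp : p.Decides W s P)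
    (hW : 1 < W) : (bin .eq p (lit 0)).Decides W s (¬P) := by
  obtain ⟨v, hv, -, hvP⟩ := hp
  rw [← hvP, not_not]
  exact decides_eq hv (eval_lit (by omega)) hW

/-! ## Execution of programs -/

/-- The program halts within `T` steps in a store that satisfies `Q`. -/
def Program.Ensures (W : ℕ) (p : Program) (s : Store) (T : ℕ) (Q : Store → Prop) : Prop :=
  ∃ t s', Run W p s t s' ∧ t ≤ T ∧ Q s'

theorem Program.Ensures.seq {W : ℕ} {p q : Program} {s : Store} {T T' : ℕ} {Q R : Store → Prop}
    (hp : p.Ensures W s T Q) (hq : ∀ s', Q s' → q.Ensures W s' T' R) :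
    (Program.seq p q).Ensures W s (T + T') R := by
  obtain ⟨t, s', hr, ht, hs'⟩ := hp
  obtain ⟨t', s'', hr', ht', hs''⟩ := hq s' hs'
  exact ⟨t + t', s'', .seq _ _ _ _ _ _ _ hr hr', Nat.add_le_add ht ht', hs''⟩

theorem Program.ensures_assign {W : ℕ} {s : Store} {x : ℕ} {e : Term} {v : ℕ} {Q : Store → Prop}
    (he : e.eval W s = some v) (hQ : Q (s.setVar x v)) :
    (assign x e).Ensures W s (e.cost + 1) Q :=
  ⟨_, _, .assign _ _ _ _ he, le_rfl, hQ⟩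

theorem Program.ensures_store {W : ℕ} {s : Store} {a : ℕ} {i e : Term} {j v : ℕ}
    {Q : Store → Prop} (hi : i.eval W s = some j) (he : e.eval W s = some v)
    (hQ : Q (s.setArr a j v)) : (store a i e).Ensures W s (i.cost + e.cost + 1) Q :=
  ⟨_, _, .store _ _ _ _ _ _ hi he, le_rfl, hQ⟩

/-- A loop with an invariant `I r`, which holds after `r` of `N` rounds. -/
theorem Program.ensures_loop {W : ℕ} {e : Term} {p : Program} {I : ℕ → Store → Prop} {N T : ℕ}
    (htest : ∀ r ≤ N, ∀ s, I r s → e.Decides W s (r < N))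
    (hbody : ∀ r < N, ∀ s, I r s → p.Ensures W s T (I (r + 1))) {s : Store} (hs : I 0 s) :
    (loop e p).Ensures W s (N * (e.cost + 1 + T) + (e.cost + 1)) (I N) := by
  -- Induction on the number `d` of remaining rounds.
  suffices h : ∀ d r s, r + d = N → I r s →
      (loop e p).Ensures W s (d * (e.cost + 1 + T) + (e.cost + 1)) (I N) from h N 0 s (by simp) hs
  intro d
  induction d with
  | zero =>
    rintro r s rfl hs
    obtain ⟨v, hv, -, hvr⟩ := htest r le_rfl s hs
    obtain rfl : v = 0 := by
      by_contra h
      exact lt_irrefl _ (hvr.1 h)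
    exact ⟨_, s, Run.loop_stop _ _ _ hv, by simp, hs⟩
  | succ d ih =>
    intro r s hr hs
    obtain ⟨v, hv, -, hvr⟩ := htest r (by omega) s hs
    obtain ⟨t, s', hrun, ht, hs'⟩ := hbody r (by omega) s hs
    obtain ⟨t', s'', hrun', ht', hs''⟩ := ih (r + 1) s' (by omega) hs'
    refine ⟨_, s'', .loop_step _ _ _ _ _ _ _ _ hv (hvr.2 (by omega)) hrun hrun', ?_, hs''⟩
    rw [Nat.succ_mul]
    omega

/-- A fixed number of stores into the array `a`. -/
def Program.stores (a : ℕ) : (N : ℕ) → (ix e : Fin N → Term) → Program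
  | 0, _, _ => .skip
  | N + 1, ix, e => .seq (stores a N (fun i => ix i.castSucc) fun i => e i.castSucc)
      (.store a (ix (Fin.last N)) (e (Fin.last N)))

/-- The time for a fixed number of stores. -/
def Program.storesCost (N : ℕ) (ix e : Fin N → Term) : ℕ :=
  1 + ∑ q, ((ix q).cost + (e q).cost + 1)

/-- The stores `s` and `s'` differ at most in the array `a`. -/
def Store.EqOff (a : ℕ) (s s' : Store) : Prop :=
  s'.var = s.var ∧ ∀ b ≠ a, s'.arr b = s.arr b

/-- The expressions must keep their values in every store that differs only in array `a`, because
each is evaluated after earlier stores. This is why the exchange goes through a buffer: its entries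
are read from the very array to be overwritten. -/
theorem Program.ensures_stores {W a N : ℕ} {ix e : Fin N → Term} {s : Store} {j v : Fin N → ℕ}
    (hj : Injective j)
    (hix : ∀ s', Store.EqOff a s s' → ∀ q, (ix q).eval W s' = some (j q))
    (he : ∀ s', Store.EqOff a s s' → ∀ q, (e q).eval W s' = some (v q)) :
    (stores a N ix e).Ensures W s (storesCost N ix e) fun s' => Store.EqOff a s s' ∧
      (∀ q, s'.arr a (j q) = v q) ∧ ∀ p ∉ Set.range j, s'.arr a p = s.arr a p := by
  induction N with
  | zero => exact ⟨1, s, .skip s, by simp [storesCost], ⟨rfl, fun _ _ => rfl⟩, fun q => q.elim0,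
      fun _ _ => rfl⟩
  | succ N ih =>
    rw [storesCost, Fin.sum_univ_castSucc, ← add_assoc]
    refine (ih (hj.comp (Fin.castSucc_injective N)) (fun s' h q => hix s' h q.castSucc)
      fun s' h q => he s' h q.castSucc).seq ?_
    rintro s' ⟨hs', hv, hp⟩
    refine ensures_store (hix s' hs' _) (he s' hs' _) ⟨⟨hs'.1, fun b hb => ?_⟩, ?_, ?_⟩
    · simp [Store.setArr, update_of_ne hb, hs'.2 b hb]
    · intro q
      induction q using Fin.lastCases with
      | last => simp [Store.setArr]
      | cast q =>
        have hne : j q.castSucc ≠ j (Fin.last N) := fun h =>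
          (Fin.castSucc_lt_last q).ne (hj h)
        simp only [Store.setArr, update_self, update_of_ne hne]
        exact hv q
    · intro p hp'
      have hne : p ≠ j (Fin.last N) := fun h => hp' ⟨_, h.symm⟩
      simp only [Store.setArr, update_self, update_of_ne hne]
      exact hp p fun ⟨q, hq⟩ => hp' ⟨_, hq⟩

/-! ## The algorithm

Register `0` holds `n`, register `1` counts the entries of array `1` during the initialization,
register `2` holds the current row, and register `3` encodes the tuple of rows to be exchanged by
its digits in base `n`. Array `1` holds the rows, and array `2` is a buffer for the exchange. -/

/-- The `l`-th row to be exchanged. -/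
def rowTerm (K : ℕ) (l : Fin (K + 1)) : Term :=
  if l = 0 then .var 2 else .bin .mod (.bin .div (.var 3) ((Term.var 0).pow l)) (.var 0)

/-- The position in array `1` of the `i`-th entry of the `l`-th row to be exchanged. -/
def positionTerm (K : ℕ) (l i : Fin (K + 1)) : Term :=
  .bin .add (.bin .mul (rowTerm K l) (.lit (K + 1))) (.lit i)

/-- The `i`-th entry of the `l`-th row after the exchange. -/
def entryTerm (K : ℕ) (l i : Fin (K + 1)) : Term :=
  .get 1 (positionTerm K (exchange i l) i)

/-- Is the `l`-th row an edge after the exchange? -/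
def edgeTerm (K : ℕ) (l : Fin (K + 1)) : Term :=
  .get 0 (Term.sum (K + 1) fun i => .bin .mul (entryTerm K l i) ((Term.var 0).pow i))

/-- Are the `p`-th and the `q`-th row distinct, unless `p = q`? -/
def distinctTerm (K : ℕ) (p q : Fin (K + 1)) : Term :=
  if p = q then .lit 1 else .bin .eq (.bin .eq (rowTerm K p) (rowTerm K q)) (.lit 0)

/-- Can the rows be exchanged? -/
def exchangeTerm (K : ℕ) : Term :=
  .bin .mul (Term.prod (K + 1) fun p => Term.prod (K + 1) fun q => distinctTerm K p q)
    (Term.prod (K + 1) fun l => edgeTerm K l)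

/-- Fill the rows: the `j`-th row becomes `(j, …, j)`. -/
def initProgram (K : ℕ) : Program :=
  .loop (.bin .lt (.var 1) (.bin .mul (.var 0) (.lit (K + 1))))
    (.seq (.store 1 (.var 1) (.bin .div (.var 1) (.lit (K + 1))))
      (.assign 1 (.bin .add (.var 1) (.lit 1))))

/-- Search for rows that can be exchanged. -/
def searchProgram (K : ℕ) : Program :=
  .loop (.bin .eq (exchangeTerm K) (.lit 0)) (.assign 3 (.bin .add (.var 3) (.lit 1)))

/-- Write the rows after the exchange into the buffer. -/
def loadProgram (K : ℕ) : Program :=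
  .stores 2 ((K + 1) * (K + 1)) (fun q => .lit q) fun q => entryTerm K q.divNat q.modNat

/-- Copy the buffer into the rows. -/
def saveProgram (K : ℕ) : Program :=
  .stores 1 ((K + 1) * (K + 1)) (fun q => positionTerm K q.divNat q.modNat) fun q =>
    .get 2 (.lit q)

/-- Make the current row an edge, and go on to the next row. -/
def roundProgram (K : ℕ) : Program :=
  .seq (.assign 3 (.lit 0)) (.seq (searchProgram K) (.seq (loadProgram K) (.seq (saveProgram K)
    (.assign 2 (.bin .add (.var 2) (.lit 1))))))

/-- The algorithm. -/
def matchingProgram (K : ℕ) : Program :=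
  .seq (initProgram K) (.loop (.bin .lt (.var 2) (.var 0)) (roundProgram K))

/-! ## Correctness -/

/-- The conditions on the word bound. -/
structure WordBound (K n W : ℕ) : Prop where
  lit_lt : (K + 1) * (K + 1) < W
  rows_lt : n * (K + 1) < W
  pow_lt : n ^ (K + 1) < W
  one_lt : 1 < W

/-- The store holds the adjacency tensor of `H`, and the rows `m`. -/
structure Holds {K n : ℕ} (H : KGraph (Fin (K + 1) × Fin n) (K + 1))
    (m : Fin n → Fin (K + 1) → Fin n) (s : Store) : Prop where
  size : s.var 0 = n
  tensor : s.arr 0 = (inputStore H).arr 0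
  rows : ∀ (j : Fin n) (i : Fin (K + 1)), s.arr 1 (j * (K + 1) + i) = m j i

/-- The rows to be exchanged if the registers `2` and `3` hold `a` and `x`. -/
def rowTuple {K n : ℕ} (a : Fin n) (x : ℕ) (l : Fin (K + 1)) : Fin n :=
  if l = 0 then a else ⟨x / n ^ (l : ℕ) % n, Nat.mod_lt _ a.pos⟩

/-- The code is the number with base-n digits `J`. Digit 0 is ignored when decoding; keeping it
costs a factor n in the search, which the time bound allows. -/
theorem exists_rowTuple_eq {K n : ℕ} (J : Fin (K + 1) → Fin n) :
    ∃ x < n ^ (K + 1), rowTuple (J 0) x = J := by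
  refine ⟨finFunctionFinEquiv J, Fin.is_lt _, ?_⟩
  funext l
  unfold rowTuple
  split_ifs with hl
  · rw [hl]
  -- The inverse of `finFunctionFinEquiv` is digit extraction by definition.
  · conv_rhs => rw [← finFunctionFinEquiv.symm_apply_apply J]
    rfl

theorem sum_mul_pow_lt {k n : ℕ} (w : Fin k → Fin n) : ∑ i, (w i : ℕ) * n ^ (i : ℕ) < n ^ k :=
  (finFunctionFinEquiv w).is_lt

open Classical in
-- Base-n encoding is injective, so a tensor entry refers to one tuple only.
theorem inputStore_arr_zero {k n : ℕ} (H : KGraph (Fin k × Fin n) k) (w : Fin k → Fin n) :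
    (inputStore H).arr 0 (∑ i, (w i : ℕ) * n ^ (i : ℕ)) = if H.IsEdge w then 1 else 0 := by
  have : (∃ v : Fin k → Fin n, ∑ i, (w i : ℕ) * n ^ (i : ℕ) = ∑ i, (v i : ℕ) * n ^ (i : ℕ) ∧
      transversal univ v ∈ H.edges) ↔ H.IsEdge w := by
    constructor
    · rintro ⟨v, hv, h⟩
      obtain rfl : w = v := finFunctionFinEquiv.injective (Fin.ext hv)
      exact h
    · exact fun h => ⟨w, rfl, h⟩
  simp [inputStore, this]

theorem row_mul_add_lt {K n : ℕ} (j : Fin n) (i : Fin (K + 1)) :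
    (j : ℕ) * (K + 1) + i < n * (K + 1) := by
  have := Nat.mul_le_mul_right (K + 1) j.is_lt
  have := i.is_lt
  rw [Nat.succ_mul] at *
  omega

theorem row_mul_add_inj {K n : ℕ} {j j' : Fin n} {i i' : Fin (K + 1)}
    (h : (j : ℕ) * (K + 1) + i = j' * (K + 1) + i') : j = j' ∧ i = i' := by
  have h1 := congrArg (· / (K + 1)) h
  have h2 := congrArg (· % (K + 1)) h
  simp only [Nat.mul_add_mod', Nat.mod_eq_of_lt i.is_lt, Nat.mod_eq_of_lt i'.is_lt] at h2
  simp only [Nat.mul_comm _ (K + 1), Nat.mul_add_div K.succ_pos, Nat.div_eq_of_lt i.is_lt,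
    Nat.div_eq_of_lt i'.is_lt, add_zero] at h1
  exact ⟨Fin.ext h1, Fin.ext h2⟩

section

variable {K n W : ℕ} (hW : WordBound K n W) {s : Store} {a : Fin n} {x : ℕ}
include hW

theorem eval_pow_size (h0 : s.var 0 = n) (hn : 0 < n) (i : Fin (K + 1)) :
    ((Term.var 0).pow i).eval W s = some (n ^ (i : ℕ)) :=
  Term.eval_pow (Term.eval_var h0) hn _
    ((Nat.pow_le_pow_right hn i.is_lt.le).trans_lt hW.pow_lt)

theorem eval_rowTerm (h0 : s.var 0 = n) (h2 : s.var 2 = a) (h3 : s.var 3 = x)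
    (hx : x < W) (l : Fin (K + 1)) :
    (rowTerm K l).eval W s = some (rowTuple a x l : ℕ) := by
  unfold rowTerm rowTuple
  split_ifs
  · exact Term.eval_var h2
  · have hdiv : x / n ^ (l : ℕ) < W := (Nat.div_le_self _ _).trans_lt hx
    exact Term.eval_bin (o := .mod) (Term.eval_bin (o := .div) (Term.eval_var h3)
      (eval_pow_size hW h0 a.pos l) hdiv) (Term.eval_var h0) ((Nat.mod_le _ _).trans_lt hdiv)

theorem eval_positionTerm (h0 : s.var 0 = n) (h2 : s.var 2 = a) (h3 : s.var 3 = x)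
    (hx : x < W) (l i : Fin (K + 1)) :
    (positionTerm K l i).eval W s = some ((rowTuple a x l : ℕ) * (K + 1) + i) := by
  have h := (row_mul_add_lt (rowTuple a x l) i).trans hW.rows_lt
  have hK : K + 1 < W := (Nat.le_mul_self _).trans_lt hW.lit_lt
  refine Term.eval_bin (o := .add) (Term.eval_bin (o := .mul) (eval_rowTerm hW h0 h2 h3 hx l)
    (Term.eval_lit hK) ?_) (Term.eval_lit (i.is_lt.trans hK)) h
  exact (Nat.le_add_right _ _).trans_lt h

variable {H : KGraph (Fin (K + 1) × Fin n) (K + 1)} {m : Fin n → Fin (K + 1) → Fin n}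

theorem eval_entryTerm (hs : Holds H m s) (h2 : s.var 2 = a) (h3 : s.var 3 = x)
    (hx : x < W) (l i : Fin (K + 1)) :
    (entryTerm K l i).eval W s = some (m (rowTuple a x (exchange i l)) i : ℕ) :=
  Term.eval_get (eval_positionTerm hW hs.size h2 h3 hx _ i) (hs.rows _ _)

theorem decides_edgeTerm (hs : Holds H m s) (h2 : s.var 2 = a) (h3 : s.var 3 = x)
    (hx : x < W) (l : Fin (K + 1)) :
    (edgeTerm K l).Decides W s (H.IsEdge fun i => m (rowTuple a x (exchange i l)) i) := by
  have hsum := (sum_mul_pow_lt fun i => m (rowTuple a x (exchange i l)) i).trans hW.pow_lt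
  refine ⟨_, Term.eval_get (Term.eval_sum (fun i => ?_) hsum) (congrFun hs.tensor _), ?_⟩
  · refine Term.eval_bin (o := .mul) (eval_entryTerm hW hs h2 h3 hx l i)
      (eval_pow_size hW hs.size a.pos i) (lt_of_le_of_lt ?_ hsum)
    exact single_le_sum (f := fun i : Fin (K + 1) =>
      (m (rowTuple a x (exchange i l)) i : ℕ) * n ^ (i : ℕ)) (fun _ _ => Nat.zero_le _) (mem_univ i)
  · rw [inputStore_arr_zero]
    split_ifs with h <;> simp [h]

theorem decides_distinctTerm (h0 : s.var 0 = n) (h2 : s.var 2 = a) (h3 : s.var 3 = x)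
    (hx : x < W) (p q : Fin (K + 1)) :
    (distinctTerm K p q).Decides W s (rowTuple a x p = rowTuple a x q → p = q) := by
  unfold distinctTerm
  split_ifs with h
  · exact ⟨1, Term.eval_lit hW.one_lt, le_rfl, by simp [h]⟩
  · have := (Term.decides_eq (eval_rowTerm hW h0 h2 h3 hx p) (eval_rowTerm hW h0 h2 h3 hx q)
      hW.one_lt).not hW.one_lt
    simpa [h, ← Fin.ext_iff] using this

theorem decides_exchangeTerm (hs : Holds H m s) (h2 : s.var 2 = a) (h3 : s.var 3 = x)
    (hx : x < W) : (exchangeTerm K).Decides W s (H.CanExchange m (rowTuple a x)) :=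
  (Term.Decides.prod (fun p => Term.Decides.prod
    (fun q => decides_distinctTerm hW hs.size h2 h3 hx p q) hW.one_lt) hW.one_lt).mul
    (Term.Decides.prod (fun l => decides_edgeTerm hW hs h2 h3 hx l) hW.one_lt) hW.one_lt

/-- The time of the search. -/
def searchCost (K n : ℕ) : ℕ :=
  n ^ (K + 1) * ((Term.bin .eq (exchangeTerm K) (.lit 0)).cost + 1 + 4) +
    ((Term.bin .eq (exchangeTerm K) (.lit 0)).cost + 1)

theorem ensures_searchProgram (hs : Holds H m s) (h2 : s.var 2 = a) (h3 : s.var 3 = 0)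
    (hex : ∃ J : Fin (K + 1) → Fin n, J 0 = a ∧ H.CanExchange m J) :
    (searchProgram K).Ensures W s (searchCost K n) fun s' =>
      Holds H m s' ∧ s'.var 2 = a ∧ s'.var 3 < W ∧ H.CanExchange m (rowTuple a (s'.var 3)) := by
  classical
  have hex' : ∃ x, x < n ^ (K + 1) ∧ H.CanExchange m (rowTuple a x) := by
    obtain ⟨J, rfl, hJ⟩ := hex
    obtain ⟨x, hx, hxJ⟩ := exists_rowTuple_eq J
    exact ⟨x, hx, hxJ.symm ▸ hJ⟩
  obtain ⟨hN, hNex⟩ := Nat.find_spec hex'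
  set N := Nat.find hex'
  have hlt : ∀ r ≤ N, r < W := fun r hr => (hr.trans_lt hN).trans hW.pow_lt
  -- With `N` the least successful code, the loop test at code `r ≤ N` is equivalent to `r < N`, the
  -- form that `Program.ensures_loop` needs.
  have hmin : ∀ r ≤ N, (r < N ↔ ¬H.CanExchange m (rowTuple a r)) := by
    intro r hr
    constructor
    · exact fun h h' => Nat.find_min hex' h ⟨h.trans hN, h'⟩
    · exact fun h => lt_of_le_of_ne hr fun h' => h (h' ▸ hNex)
  obtain ⟨t, s', hrun, ht, hs', h2', h3'⟩ := Program.ensures_loop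
    (W := W) (e := .bin .eq (exchangeTerm K) (.lit 0)) (p := .assign 3 (.bin .add (.var 3) (.lit 1)))
    (I := fun r s => Holds H m s ∧ s.var 2 = a ∧ s.var 3 = r) (N := N) (T := 4)
    (fun r hr s h => by
      rw [hmin r hr]
      exact (decides_exchangeTerm hW h.1 h.2.1 h.2.2 (hlt r hr)).not hW.one_lt)
    (fun r hr s h => by
      refine Program.ensures_assign (v := r + 1) (Term.eval_bin (o := .add)
        (Term.eval_var h.2.2) (Term.eval_lit hW.one_lt) (hlt _ hr)) ⟨⟨?_, h.1.tensor, h.1.rows⟩, ?_, ?_⟩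
      · simpa [Store.setVar] using h.1.size
      · simpa [Store.setVar] using h.2.1
      · simp [Store.setVar])
    (s := s) ⟨hs, h2, h3⟩
  refine ⟨t, s', hrun, ht.trans ?_, hs', h2', h3' ▸ hlt _ le_rfl, h3' ▸ hNex⟩
  exact Nat.add_le_add_right (Nat.mul_le_mul_right _ hN.le) _

theorem ensures_loadProgram (hs : Holds H m s) (h2 : s.var 2 = a) (hx : s.var 3 < W) :
    (loadProgram K).Ensures W s
      (Program.storesCost ((K + 1) * (K + 1)) (fun q => .lit q) fun q =>
        entryTerm K q.divNat q.modNat) fun s' =>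
      Holds H m s' ∧ s'.var = s.var ∧ ∀ q : Fin ((K + 1) * (K + 1)),
        s'.arr 2 q = m (rowTuple a (s.var 3) (exchange q.modNat q.divNat)) q.modNat := by
  have hHolds : ∀ s', Store.EqOff 2 s s' → Holds H m s' := fun s' h =>
    ⟨by rw [h.1, hs.size], by rw [h.2 0 (by simp), hs.tensor],
      by simpa only [h.2 1 (by simp)] using hs.rows⟩
  obtain ⟨t, s', hrun, ht, hs', hv, -⟩ := Program.ensures_stores (W := W) (a := 2) (s := s)
    (ix := fun q : Fin ((K + 1) * (K + 1)) => .lit q)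
    (e := fun q => entryTerm K q.divNat q.modNat) Fin.val_injective
    (fun s' _ q => Term.eval_lit (q.is_lt.trans hW.lit_lt))
    (fun s' h q => eval_entryTerm hW (hHolds s' h) (by rw [h.1, h2]) (by rw [h.1]) hx
      q.divNat q.modNat)
  exact ⟨t, s', hrun, ht, hHolds s' hs', hs'.1, hv⟩

theorem ensures_saveProgram (hs : Holds H m s) (h2 : s.var 2 = a) (hx : s.var 3 < W)
    {J : Fin (K + 1) ↪ Fin n} (hJ : ⇑J = rowTuple a (s.var 3))
    (hbuf : ∀ q : Fin ((K + 1) * (K + 1)),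
      s.arr 2 q = m (J (exchange q.modNat q.divNat)) q.modNat) :
    (saveProgram K).Ensures W s
      (Program.storesCost ((K + 1) * (K + 1)) (fun q => positionTerm K q.divNat q.modNat) fun q =>
        .get 2 (.lit q)) fun s' => Holds H (exchangeRows m J) s' ∧ s'.var = s.var := by
  obtain ⟨t, s', hrun, ht, hs', hv, hp⟩ := Program.ensures_stores (W := W) (a := 1) (s := s)
    (ix := fun q : Fin ((K + 1) * (K + 1)) => positionTerm K q.divNat q.modNat)
    (e := fun q => .get 2 (.lit q))
    (j := fun q => (J q.divNat : ℕ) * (K + 1) + (q.modNat : Fin (K + 1)))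
    (fun q q' h => by
      obtain ⟨h1, h2⟩ := row_mul_add_inj h
      exact finProdFinEquiv.symm.injective (Prod.ext (J.injective h1) h2))
    (fun s' h q => by
      rw [hJ]
      exact eval_positionTerm hW (by rw [h.1, hs.size]) (by rw [h.1, h2]) (by rw [h.1]) hx _ _)
    (fun s' h q => Term.eval_get (Term.eval_lit (q.is_lt.trans hW.lit_lt))
      (by rw [h.2 2 (by simp), hbuf]))
  refine ⟨t, s', hrun, ht, ⟨by rw [hs'.1, hs.size], by rw [hs'.2 0 (by simp), hs.tensor], ?_⟩,
    hs'.1⟩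
  intro p i
  by_cases hpJ : p ∈ Set.range J
  · obtain ⟨l, rfl⟩ := hpJ
    have := hv (finProdFinEquiv (l, i))
    have hdm : ((finProdFinEquiv (l, i)).divNat, (finProdFinEquiv (l, i)).modNat) = (l, i) :=
      finProdFinEquiv.symm_apply_apply (l, i)
    rw [Prod.mk.injEq] at hdm
    rw [hdm.1, hdm.2] at this
    rw [this, exchangeRows_apply]
  · rw [exchangeRows_apply_of_notMem m hpJ, hp, hs.rows]
    rintro ⟨q, hq⟩
    exact hpJ ⟨_, (row_mul_add_inj hq).1⟩

/-- The time of a round. -/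
def roundCost (K n : ℕ) : ℕ :=
  2 + (searchCost K n +
    (Program.storesCost ((K + 1) * (K + 1)) (fun q => .lit q) (fun q =>
        entryTerm K q.divNat q.modNat) +
      (Program.storesCost ((K + 1) * (K + 1)) (fun q => positionTerm K q.divNat q.modNat) (fun q =>
        .get 2 (.lit q)) + 4)))

/-- The invariant of the main loop: the first `r` rows are edges. -/
def RoundInvariant (H : KGraph (Fin (K + 1) × Fin n) (K + 1)) (r : ℕ) (s : Store) : Prop :=
  s.var 2 = r ∧ ∃ m : Fin n → Fin (K + 1) → Fin n, Holds H m s ∧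
    (∀ i, Injective fun j => m j i) ∧ ∀ j : Fin n, (j : ℕ) < r → H.IsEdge (m j)

theorem ensures_roundProgram
    (hex : ∀ m : Fin n → Fin (K + 1) → Fin n, (∀ i, Injective fun j => m j i) → ∀ a,
      ∃ J : Fin (K + 1) → Fin n, J 0 = a ∧ H.CanExchange m J)
    {r : ℕ} (hr : r < n) (hs : RoundInvariant H r s) :
    (roundProgram K).Ensures W s (roundCost K n) (RoundInvariant H (r + 1)) := by
  obtain ⟨h2, m, hs, hm, hE⟩ := hs
  lift r to Fin n using hr
  have hrW : (r : ℕ) + 1 < W :=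
    lt_of_le_of_lt (Nat.succ_le_of_lt r.is_lt) ((Nat.le_mul_of_pos_right n K.succ_pos).trans_lt
      hW.rows_lt)
  refine (Program.ensures_assign (Q := fun s' => Holds H m s' ∧ s'.var 2 = r ∧ s'.var 3 = 0)
    (Term.eval_lit (by omega)) ⟨⟨?_, hs.tensor, hs.rows⟩, ?_, ?_⟩).seq fun s₁ h₁ => ?_
  · simpa [Store.setVar] using hs.size
  · simpa [Store.setVar] using h2
  · simp [Store.setVar]
  refine (ensures_searchProgram hW h₁.1 h₁.2.1 h₁.2.2 (hex m hm r)).seq ?_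
  rintro s₂ ⟨hs₂, h2₂, h3₂, hinj, hEx⟩
  refine (ensures_loadProgram hW hs₂ h2₂ h3₂).seq ?_
  rintro s₃ ⟨hs₃, hvar₃, hbuf⟩
  let J : Fin (K + 1) ↪ Fin n := ⟨rowTuple r (s₂.var 3), hinj⟩
  refine (ensures_saveProgram hW hs₃ (by rw [hvar₃, h2₂]) (by rwa [hvar₃])
    (J := J) (by rw [hvar₃]; rfl) hbuf).seq ?_
  rintro s₄ ⟨hs₄, hvar₄⟩
  refine Program.ensures_assign (v := r + 1) (Term.eval_bin (o := .add)
    (Term.eval_var (by rw [hvar₄, hvar₃, h2₂])) (Term.eval_lit hW.one_lt) hrW)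
    ⟨by simp [Store.setVar], exchangeRows m J, ⟨?_, hs₄.tensor, hs₄.rows⟩,
      exchangeRows_injective hm J, ?_⟩
  · simpa [Store.setVar] using hs₄.size
  intro j hj
  by_cases hjJ : j ∈ Set.range J
  · obtain ⟨l, rfl⟩ := hjJ
    have : exchangeRows m J (J l) = fun i => m (J (exchange i l)) i :=
      funext fun i => exchangeRows_apply m J l i
    rw [this]
    exact hEx l
  · rw [exchangeRows_apply_of_notMem m hjJ]
    -- Row `r` is `J 0`, so a row outside the exchange with index below `r + 1` lies below `r` and
    -- was an edge already.
    refine hE j (lt_of_le_of_ne (Nat.le_of_lt_succ hj) fun h => hjJ ⟨0, ?_⟩)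
    simp [J, rowTuple, Fin.ext_iff, h]

/-- The time of the initialization. -/
def initCost (K n : ℕ) : ℕ :=
  n * (K + 1) * (5 + 1 + (5 + 4)) + (5 + 1)

theorem ensures_initProgram :
    (initProgram K).Ensures W (inputStore H) (initCost K n) (RoundInvariant H 0) := by
  have hK : K + 1 < W := (Nat.le_mul_self _).trans_lt hW.lit_lt
  obtain ⟨t, s', hrun, ht, h0, h1, h2, htensor, hrows⟩ := Program.ensures_loop
    (W := W) (e := .bin .lt (.var 1) (.bin .mul (.var 0) (.lit (K + 1))))
    (p := .seq (.store 1 (.var 1) (.bin .div (.var 1) (.lit (K + 1))))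
      (.assign 1 (.bin .add (.var 1) (.lit 1))))
    (I := fun r s => s.var 0 = n ∧ s.var 1 = r ∧ s.var 2 = 0 ∧ s.arr 0 = (inputStore H).arr 0 ∧
      ∀ p < r, s.arr 1 p = p / (K + 1))
    (N := n * (K + 1)) (T := 5 + 4)
    (fun r hr s h => Term.decides_lt (Term.eval_var h.2.1) (Term.eval_bin (o := .mul)
      (Term.eval_var h.1) (Term.eval_lit hK) hW.rows_lt) hW.one_lt)
    (fun r hr s ⟨h0, h1, h2, htensor, hrows⟩ => by
      have hrW : r + 1 < W := lt_of_le_of_lt hr hW.rows_lt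
      refine (Program.ensures_store (Q := fun s => s.var 0 = n ∧ s.var 1 = r ∧ s.var 2 = 0 ∧
        s.arr 0 = (inputStore H).arr 0 ∧ ∀ p < r + 1, s.arr 1 p = p / (K + 1))
        (Term.eval_var h1) (Term.eval_bin (o := .div) (Term.eval_var h1) (Term.eval_lit hK)
          ((Nat.div_le_self _ _).trans_lt (by omega))) ⟨h0, h1, h2, ?_, ?_⟩).seq ?_
      · simpa [Store.setArr] using htensor
      · intro p hp
        rcases eq_or_ne p r with rfl | hpr
        · simp [Store.setArr, BinOp.apply]
        · simpa [Store.setArr, hpr] using hrows p (by omega)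
      · rintro s' ⟨h0, h1, h2, htensor, hrows⟩
        refine Program.ensures_assign (v := r + 1) (Term.eval_bin (o := .add) (Term.eval_var h1)
          (Term.eval_lit hW.one_lt) hrW) ⟨?_, ?_, ?_, htensor, hrows⟩ <;>
        simp [Store.setVar, h0, h2])
    (s := inputStore H) (by simp [inputStore])
  -- Initially every column is the identity, and no row needs to be an edge yet.
  refine ⟨t, s', hrun, ht, h2, fun j _ => j, ⟨h0, htensor, fun j i => ?_⟩, fun _ => injective_id,
    fun j hj => absurd hj (Nat.not_lt_zero _)⟩
  rw [hrows _ (row_mul_add_lt j i), Nat.mul_comm, Nat.mul_add_div K.succ_pos,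
    Nat.div_eq_of_lt i.is_lt, add_zero]

theorem ensures_matchingProgram
    (hex : ∀ m : Fin n → Fin (K + 1) → Fin n, (∀ i, Injective fun j => m j i) → ∀ a,
      ∃ J : Fin (K + 1) → Fin n, J 0 = a ∧ H.CanExchange m J) :
    (matchingProgram K).Ensures W (inputStore H)
      (initCost K n + (n * (3 + 1 + roundCost K n) + (3 + 1))) (OutputsPerfectMatching H) := by
  refine (ensures_initProgram hW).seq fun s hs => ?_
  obtain ⟨t, s', hrun, ht, -, m, hs', hm, hE⟩ := Program.ensures_loop
    (e := .bin .lt (.var 2) (.var 0)) (I := RoundInvariant H) (N := n)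
    (fun r _ s ⟨h2, m, h, _⟩ => Term.decides_lt (Term.eval_var h2) (Term.eval_var h.size) hW.one_lt)
    (fun r hr s hs => ensures_roundProgram hW hex hr hs) hs
  exact ⟨t, s', hrun, ht, m, hs'.rows,
    KGraph.isPerfectMatching_image_transversal hm fun j => hE j j.is_lt⟩

end

/-! ### Running time, word bound and the main theorem -/

theorem exists_cost_le (K : ℕ) : ∃ C, ∀ n, 1 ≤ n →
    initCost K n + (n * (3 + 1 + roundCost K n) + (3 + 1)) ≤ C * n ^ (K + 2) := by
  unfold initCost roundCost searchCost
  -- The costs of these fixed program pieces depend only on K, so they enter the constant.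
  generalize (Term.bin .eq (exchangeTerm K) (.lit 0)).cost = c₁
  generalize Program.storesCost _ _ _ = c₂
  generalize Program.storesCost _ _ _ = c₃
  refine ⟨(K + 1) * 15 + c₁ + 5 + c₁ + c₂ + c₃ + 21, fun n hn => ?_⟩
  have h1 : 1 ≤ n ^ (K + 1) := Nat.one_le_pow _ _ hn
  have h2 : n ≤ n * n ^ (K + 1) := Nat.le_mul_of_pos_right n h1
  have h3 : 1 ≤ n * n ^ (K + 1) := hn.trans h2
  rw [show n ^ (K + 2) = n * n ^ (K + 1) from pow_succ' n (K + 1)]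
  set y := n ^ (K + 1)
  nlinarith [Nat.mul_le_mul_right ((K + 1) * 15) h2, Nat.mul_le_mul_right (c₁ + c₂ + c₃ + 11) h2]

theorem wordBound_pow {K n : ℕ} (hK : 1 ≤ K) (hn : 2 * (K + 1) ^ 2 < n) :
    WordBound K n (n ^ (K + 2)) := by
  have h1 : 1 < n := by nlinarith
  have hKn : K + 1 < n := by nlinarith
  have h2 : n * n ≤ n ^ (K + 2) := by
    rw [← sq]
    exact Nat.pow_le_pow_right h1.le (by omega)
  exact ⟨by nlinarith, by nlinarith, Nat.pow_lt_pow_right h1 (by omega), by nlinarith⟩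

end HyperMatching

theorem theorem5p7 (k : ℕ) (hk : 2 ≤ k) :
    ∃ (P : HyperMatching.Program) (c C : ℕ) (γ₀ : ℝ), 0 < γ₀ ∧
      ∀ γ : ℝ, 0 < γ → γ < γ₀ → ∃ n₀ : ℕ, ∀ n : ℕ, n₀ ≤ n →
        ∀ H : HyperMatching.KGraph (Fin k × Fin n) k, H.IsPartite →
          (1 - γ) * (n : ℝ) ^ (k - 1) ≤ (H.minDegree {⟨0, by omega⟩} : ℝ) →
          (1 - γ) * (n : ℝ) ≤ (H.minDegree (Finset.univ \ {⟨0, by omega⟩}) : ℝ) →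
          ∃ (t : ℕ) (s : HyperMatching.Store),
            HyperMatching.Run (n ^ c) P (HyperMatching.inputStore H) t s ∧
            t ≤ C * n ^ (4 * (k - 1)) ∧
            HyperMatching.OutputsPerfectMatching H s := by
  obtain ⟨K, rfl⟩ : ∃ K, k = K + 1 := ⟨k - 1, by omega⟩
  obtain ⟨C, hC⟩ := HyperMatching.exists_cost_le K
  -- The threshold γ₀ = 1/(2k) lets non-edges use up at most half of the tuples; the choice of n₀
  -- leaves less than half to coincidences and is independent of γ.
  refine ⟨HyperMatching.matchingProgram K, K + 2, C, 1 / (2 * (K + 1)), by positivity,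
    fun γ _ hγ => ⟨2 * (K + 1) ^ 2 + 1, fun n hn H hH h₁ h₂ => ?_⟩⟩
  have hγ' : 2 * (K + 1) * γ ≤ 1 := by
    rw [lt_div_iff₀ (by positivity)] at hγ
    linarith
  obtain ⟨t, s, hrun, ht, hs⟩ := HyperMatching.ensures_matchingProgram (H := H)
    (HyperMatching.wordBound_pow (by omega) hn)
    fun m hm a => hH.exists_canExchange hγ' hn h₁ h₂ hm a
  -- K + 2 ≤ 4K, since K ≥ 1.
  refine ⟨t, s, hrun, ht.trans ((hC n (by omega)).trans ?_), hs⟩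
  exact Nat.mul_le_mul_left _ (Nat.pow_le_pow_right (by omega) (by omega))
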